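/- For $n\ge 1$ let $x_{k,n}=\cos\frac{(2k-1)\pi}{2n}$ ($1\le k\le n$) be the Chebyshev nodes, let $l_{k,n}(x)=\prod_{1\le j\le n,\,j\ne k}\frac{x-x_{j,n}}{x_{k,n}-x_{j,n}}$ be the Lagrange fundamental polynomials, and let $L_n(f;x)=\sum_{k=1}^n f(x_{k,n})\,l_{k,n}(x)$ be the Lagrange operator on $C[-1,1]$. Put $$\Lambda_n(x)=\sum_{k=1}^n|l_{k,n}(x)|,\qquad T(f,g;x)=L_n(fg;x)-L_n(f;x)\,L_n(g;x),$$ $$\mathrm{osc}_{L_n}(f)=\sup\{|f(x_{k,n})-f(x_{m,n})| : 1\le k<m\le n\}$$ (with $\mathrm{osc}_{L_1}(f)=0$). Then there is an absolute constant $c>0$ such that for all $n\ge 1$, all $f,g\in C[-1,1]$, all $x\in[-1,1]$ and all real $t$ with $x=\cos t$, $$|T(f,g;x)|\le \mathrm{osc}_{L_n}(f)\,\mathrm{osc}_{L_n}(g)\sum_{1\le k<m\le n}|l_{k,n}(x)\,l_{m,n}(x)|$$ and $$\mathrm{osc}_{L_n}(f)\,\mathrm{osc}_{L_n}(g)\sum_{1\le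 k<m\le n}|l_{k,n}(x)\,l_{m,n}(x)|\le \mathrm{osc}_{L_n}(f)\,\mathrm{osc}_{L_n}(g)\cdot\frac{\Lambda_n(x)^2-c\left[1+\cos^2(nt)\,\frac{\pi^2}{6}\right]}{2}.$$ -/

import Mathlib

noncomputable section

/-- The Chebyshev node `x_{k,n} = cos ((2k - 1)π / (2n))`, for `1 ≤ k ≤ n`, as a point of `[-1, 1]`. -/
def chebyshevNode (n k : ℕ) : Set.Icc (-1 : ℝ) 1 :=
  ⟨Real.cos ((2 * (k : ℝ) - 1) / (2 * (n : ℝ)) * Real.pi), Real.cos_mem_Icc _⟩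

/-- The value `l_{k,n}(x)` of the Lagrange fundamental polynomial
`∏_{j ≠ k} (x - x_{j,n}) / (x_{k,n} - x_{j,n})` of the Chebyshev nodes `x_{1,n}, …, x_{n,n}`. -/
def lagrangeFundamental (n k : ℕ) (x : ℝ) : ℝ :=
  (Lagrange.basis (Finset.Icc 1 n) (fun j => (chebyshevNode n j : ℝ)) k).eval x

/-- The Lagrange operator `L_n(f; x) = ∑_{k=1}^n f(x_{k,n}) l_{k,n}(x)` at the Chebyshev nodes. -/
def lagrangeOperator (n : ℕ) (f : C(Set.Icc (-1 : ℝ) 1, ℝ)) (x : ℝ) : ℝ :=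
  ∑ k ∈ Finset.Icc 1 n, f (chebyshevNode n k) * lagrangeFundamental n k x

/-- The Lebesgue function `Λ_n(x) = ∑_{k=1}^n |l_{k,n}(x)|`. -/
def lebesgueFunction (n : ℕ) (x : ℝ) : ℝ :=
  ∑ k ∈ Finset.Icc 1 n, |lagrangeFundamental n k x|

/-- The functional `T(f, g; x) = L_n(f g; x) - L_n(f; x) L_n(g; x)`. -/
def chebyshevFunctional (n : ℕ) (f g : C(Set.Icc (-1 : ℝ) 1, ℝ)) (x : ℝ) : ℝ :=
  lagrangeOperator n (f * g) x - lagrangeOperator n f x * lagrangeOperator n g x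

/-- The discrete oscillation
`osc_{L_n}(f) = sup { |f(x_{k,n}) - f(x_{m,n})| : 1 ≤ k < m ≤ n }`.
For `n = 1` the set is empty and the value is `0`. -/
def discreteOsc (n : ℕ) (f : C(Set.Icc (-1 : ℝ) 1, ℝ)) : ℝ :=
  sSup {d : ℝ | ∃ k m : ℕ, 1 ≤ k ∧ k < m ∧ m ≤ n ∧
    d = |f (chebyshevNode n k) - f (chebyshevNode n m)|}

/-- The sum `∑_{1 ≤ k < m ≤ n} |l_{k,n}(x) l_{m,n}(x)|`. -/
def offDiagonalSum (n : ℕ) (x : ℝ) : ℝ :=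
  ∑ m ∈ Finset.Icc 1 n, ∑ k ∈ Finset.Ico 1 m,
    |lagrangeFundamental n k x * lagrangeFundamental n m x|

end

/-! Because the fundamental polynomials sum to 1, `sum_mul_sum_sub_sum_mul_sum_eq` turns the
functional into a sum over pairs of nodes, which the oscillations bound termwise. For the second
inequality, `lebesgueFunction_sq` leaves only a lower bound for the sum of the squares of the
fundamental polynomials. The cosine bracket is at most `1 + π²/6`, so a uniform constant suffices,
and one term supplies it: at the node nearest in angle, `inv_pi_le_abs_lagrangeFundamental` gives
`1/π`. -/

open Polynomial in
/-- A polynomial of degree `#s` vanishing at all the nodes is a multiple of each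
`(X - v k) * basis s v k`, with factor its derivative at the node. -/
theorem eval_eq_basis_mul_of_vanishing {F ι : Type*} [Field F] [DecidableEq ι]
    {s : Finset ι} {v : ι → F} (hv : Set.InjOn v s) {p : F[X]} (hp : p.degree = s.card)
    (hz : ∀ i ∈ s, p.eval (v i) = 0) {k : ι} (hk : k ∈ s) (x : F) :
    p.eval x = (Lagrange.basis s v k).eval x * (x - v k) * (derivative p).eval (v k) := by
  obtain ⟨q, rfl⟩ := dvd_iff_isRoot.2 (hz k hk)
  have hd : (derivative ((X - C (v k)) * q)).eval (v k) = q.eval (v k) := by simp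
  have hq0 : q ≠ 0 := by
    rintro rfl
    simp at hp
  have hq : q.degree < s.card := by
    rw [← hp, degree_mul, degree_X_sub_C, degree_eq_natDegree hq0]
    norm_cast
    omega
  have key : q = C (q.eval (v k)) * Lagrange.basis s v k := by
    refine eq_of_degrees_lt_of_eval_index_eq s hv hq ?_ ?_
    · rw [← smul_eq_C_mul]
      refine (degree_smul_le _ _).trans_lt ?_
      rw [Lagrange.degree_basis hv hk]
      have := Finset.card_pos.2 ⟨k, hk⟩
      exact_mod_cast (by omega : s.card - 1 < s.card)
    · intro i hi
      by_cases hik : i = k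
      · subst hik
        simp [Lagrange.eval_basis_self hv hi]
      · have h := hz i hi
        have hne : v i - v k ≠ 0 := sub_ne_zero.2 fun h => hik (hv hi hk h)
        simp only [eval_mul, eval_sub, eval_X, eval_C, mul_eq_zero, hne, false_or] at h
        simp [h, Lagrange.eval_basis_of_ne (Ne.symm hik) hi]
  rw [hd]
  conv_lhs => rw [key]
  simp only [eval_mul, eval_sub, eval_X, eval_C]
  ring

/-! ### Chebyshev nodes and their fundamental polynomials -/

/-- The angle `(2k - 1)π / (2n)` of the `k`-th Chebyshev node. -/
noncomputable def chebyshevAngle (n k : ℕ) : ℝ := (2 * (k : ℝ) - 1) / (2 * (n : ℝ)) * Real.pi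

theorem coe_chebyshevNode (n k : ℕ) :
    (chebyshevNode n k : ℝ) = Real.cos (chebyshevAngle n k) := rfl

theorem mul_chebyshevAngle {n : ℕ} (hn : 1 ≤ n) (k : ℕ) :
    (n : ℝ) * chebyshevAngle n k = k * Real.pi - Real.pi / 2 := by
  have : (n : ℝ) ≠ 0 := by positivity
  unfold chebyshevAngle
  field_simp

/-- The margin is half the angular spacing; it keeps the sine at a node at least `sin (π / (2n))`.
-/
theorem chebyshevAngle_mem_Icc {n k : ℕ} (hk : k ∈ Finset.Icc 1 n) :
    chebyshevAngle n k ∈ Set.Icc (Real.pi / (2 * n)) (Real.pi - Real.pi / (2 * n)) := by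
  obtain ⟨h1, h2⟩ := Finset.mem_Icc.1 hk
  have hn : (0 : ℝ) < n := by exact_mod_cast h1.trans h2
  have h1' : (1 : ℝ) ≤ k := by exact_mod_cast h1
  have h2' : (k : ℝ) ≤ n := by exact_mod_cast h2
  have hpi := Real.pi_pos
  have e := mul_chebyshevAngle (h1.trans h2) k
  have e2 : (n : ℝ) * (Real.pi / (2 * n)) = Real.pi / 2 := by field_simp
  constructor
  · refine le_of_mul_le_mul_left ?_ hn
    rw [e, e2]
    nlinarith
  · refine le_of_mul_le_mul_left ?_ hn
    rw [mul_sub, e, e2]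
    nlinarith

theorem chebyshevNode_injOn (n : ℕ) :
    Set.InjOn (fun j => (chebyshevNode n j : ℝ)) (Finset.Icc 1 n) := by
  intro i hi j hj h
  have hn : 1 ≤ n := (Finset.mem_Icc.1 hi).1.trans (Finset.mem_Icc.1 hi).2
  have hpos : 0 < Real.pi / (2 * n) := by have := Real.pi_pos; positivity
  have mem : ∀ k ∈ Finset.Icc 1 n, chebyshevAngle n k ∈ Set.Icc 0 Real.pi := fun k hk =>
    ⟨hpos.le.trans (chebyshevAngle_mem_Icc hk).1,
      (chebyshevAngle_mem_Icc hk).2.trans (by linarith)⟩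
  have h' := Real.injOn_cos (mem i hi) (mem j hj) h
  have ei := mul_chebyshevAngle hn i
  rw [h', mul_chebyshevAngle hn j] at ei
  have : (j : ℝ) * Real.pi = i * Real.pi := by linarith
  exact_mod_cast (mul_right_cancel₀ Real.pi_ne_zero this).symm

theorem sum_lagrangeFundamental {n : ℕ} (hn : 1 ≤ n) (x : ℝ) :
    ∑ k ∈ Finset.Icc 1 n, lagrangeFundamental n k x = 1 := by
  have h := congrArg (Polynomial.eval x)
    (Lagrange.sum_basis (chebyshevNode_injOn n) (Finset.nonempty_Icc.2 hn))
  simpa [Polynomial.eval_finsetSum, lagrangeFundamental] using h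

theorem cos_mul_chebyshevAngle {n : ℕ} (hn : 1 ≤ n) (k : ℕ) :
    Real.cos (n * chebyshevAngle n k) = 0 := by
  rw [mul_chebyshevAngle hn, Real.cos_sub_pi_div_two, Real.sin_nat_mul_pi]

/-- `cos (nt) sin t_k = ± n l_k(cos t) (cos t - cos t_k)`, with the sign given by `sin (n t_k)`. -/
theorem cos_mul_sin_eq_lagrangeFundamental_mul {n k : ℕ} (hk : k ∈ Finset.Icc 1 n) (t : ℝ) :
    Real.cos (n * t) * Real.sin (chebyshevAngle n k) =
      lagrangeFundamental n k (Real.cos t) * (Real.cos t - Real.cos (chebyshevAngle n k)) *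
        (n * Real.sin (n * chebyshevAngle n k)) := by
  have hn : 1 ≤ n := (Finset.mem_Icc.1 hk).1.trans (Finset.mem_Icc.1 hk).2
  -- The nodes are the zeros of `T_n`; moreover `T_n' = n U_{n-1}` and `U_{n-1}(cos θ) sin θ = sin
  -- (nθ)`.
  have h := eval_eq_basis_mul_of_vanishing (chebyshevNode_injOn n)
    (p := Polynomial.Chebyshev.T ℝ n) (by simp) (fun i _ => by
      rw [coe_chebyshevNode, Polynomial.Chebyshev.T_real_cos]
      exact_mod_cast cos_mul_chebyshevAngle hn i) hk (Real.cos t)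
  have hU := Polynomial.Chebyshev.U_real_cos (chebyshevAngle n k) ((n : ℤ) - 1)
  rw [Polynomial.Chebyshev.T_real_cos, Polynomial.Chebyshev.T_derivative_eq_U] at h
  simp only [coe_chebyshevNode, Polynomial.eval_mul] at h
  push_cast at h hU
  rw [sub_add_cancel] at hU
  rw [h, ← hU]
  simp only [lagrangeFundamental, coe_chebyshevNode, Polynomial.eval_natCast]
  ring

theorem abs_sin_mul_chebyshevAngle {n : ℕ} (hn : 1 ≤ n) (k : ℕ) :
    |Real.sin (n * chebyshevAngle n k)| = 1 := by
  have h := Real.sin_sq_add_cos_sq (n * chebyshevAngle n k)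
  rw [cos_mul_chebyshevAngle hn] at h
  rw [← sq_eq_sq₀ (abs_nonneg _) zero_le_one, sq_abs]
  linarith

theorem abs_cos_mul {n : ℕ} (hn : 1 ≤ n) (k : ℕ) (t : ℝ) :
    |Real.cos (n * t)| = |Real.sin (n * (t - chebyshevAngle n k))| := by
  have h : (n : ℝ) * t = n * (t - chebyshevAngle n k) + n * chebyshevAngle n k := by ring
  conv_lhs => rw [h]
  rw [Real.cos_add, cos_mul_chebyshevAngle hn, mul_zero, zero_sub, abs_neg, abs_mul,
    abs_sin_mul_chebyshevAngle hn, mul_one]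

/-! ### Lower bound at the nearest node -/

/-- The fundamental polynomial of a node nearest to `x` in angle is bounded below at `x`. -/
theorem inv_pi_le_abs_lagrangeFundamental {n k : ℕ} (hk : k ∈ Finset.Icc 1 n) {t : ℝ}
    (ht : t ∈ Set.Icc 0 Real.pi) (hd : |t - chebyshevAngle n k| ≤ Real.pi / (2 * n)) :
    1 / Real.pi ≤ |lagrangeFundamental n k (Real.cos t)| := by
  have hn : 1 ≤ n := (Finset.mem_Icc.1 hk).1.trans (Finset.mem_Icc.1 hk).2
  have hn0 : (0 : ℝ) < n := by exact_mod_cast hn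
  have hpi := Real.pi_pos
  have hmem := chebyshevAngle_mem_Icc hk
  have hid := cos_mul_sin_eq_lagrangeFundamental_mul hk t
  have hcos := abs_cos_mul hn k t
  have hs1 := abs_sin_mul_chebyshevAngle hn k
  -- At the node both sides of `hid` vanish, so it gives no information there.
  by_cases hte : t = chebyshevAngle n k
  · have : lagrangeFundamental n k (Real.cos t) = 1 := by
      rw [hte]
      exact Lagrange.eval_basis_self (chebyshevNode_injOn n) hk
    rw [this, abs_one, div_le_one hpi]
    linarith [Real.pi_gt_three]
  set a := chebyshevAngle n k
  set l := lagrangeFundamental n k (Real.cos t)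
  set h := |t - a| with hh
  have hpos : 0 < h := abs_pos.2 (sub_ne_zero.2 hte)
  set δ := Real.pi / (2 * n) with hδ
  have hδ0 : 0 < δ := by positivity
  have hnδ : (n : ℝ) * δ = Real.pi / 2 := by rw [hδ]; field_simp
  have hδle : δ ≤ Real.pi / 2 := by
    have : (1 : ℝ) ≤ n := by exact_mod_cast hn
    nlinarith
  have hsa0 : 0 < Real.sin a := Real.sin_pos_of_pos_of_lt_pi (by linarith [hmem.1])
    (by linarith [hmem.2])
  have hsδ : 2 / Real.pi * δ ≤ Real.sin δ := Real.mul_le_sin hδ0.le hδle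
  have hsa : Real.sin δ ≤ Real.sin a := by
    rcases le_total a (Real.pi / 2) with h1 | h1
    · exact Real.sin_le_sin_of_le_of_le_pi_div_two (by linarith) h1 hmem.1
    · rw [← Real.sin_pi_sub a]
      exact Real.sin_le_sin_of_le_of_le_pi_div_two (by linarith) (by linarith)
        (by linarith [hmem.2])
  have hmid0 : 0 ≤ Real.sin ((t + a) / 2) :=
    Real.sin_nonneg_of_nonneg_of_le_pi (by linarith [ht.1, hmem.1])
      (by linarith [ht.2, hmem.2])
  -- Sine is 1-Lipschitz and the midpoint is within `δ/2` of `a`; `π < 4` gives `δ/2 ≤ (2/π)δ ≤ sin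
  -- δ ≤ sin a`.
  have hmid : Real.sin ((t + a) / 2) ≤ 2 * Real.sin a := by
    have h1 := (abs_le.1 (Real.abs_sin_sub_sin_le ((t + a) / 2) a)).2
    have h2 : |(t + a) / 2 - a| = h / 2 := by
      rw [hh, show (t + a) / 2 - a = (t - a) / 2 by ring, abs_div, abs_two]
    have h3 : δ / 2 ≤ 2 / Real.pi * δ := by
      rw [div_mul_eq_mul_div, le_div_iff₀ hpi]
      nlinarith [Real.pi_lt_four]
    rw [h2] at h1
    linarith
  have hdiff : |Real.cos t - Real.cos a| ≤ 2 * Real.sin a * h := by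
    rw [Real.cos_sub_cos, abs_mul, abs_mul, abs_neg, abs_two, abs_of_nonneg hmid0]
    have h1 : |Real.sin ((t - a) / 2)| ≤ h / 2 := by
      refine Real.abs_sin_le_abs.trans ?_
      rw [hh, abs_div, abs_two]
    calc 2 * Real.sin ((t + a) / 2) * |Real.sin ((t - a) / 2)|
        ≤ 2 * (2 * Real.sin a) * (h / 2) := by gcongr
      _ = 2 * Real.sin a * h := by ring
  -- Jordan's inequality applies since `n * h ≤ n * δ = π/2`.
  have hlow : 2 / Real.pi * (n * h) ≤ |Real.cos (n * t)| := by
    rw [hcos]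
    have h1 : |(n : ℝ) * (t - a)| = n * h := by rw [abs_mul, abs_of_pos hn0]
    rw [← h1]
    refine Real.mul_abs_le_abs_sin ?_
    rw [h1, ← hnδ]
    gcongr
  have habs : |Real.cos (n * t)| * Real.sin a = |l| * |Real.cos t - Real.cos a| * n := by
    have := congrArg abs hid
    rwa [abs_mul, abs_mul, abs_mul, abs_mul, hs1, abs_of_pos hsa0, abs_of_pos hn0, mul_one]
      at this
  have hc : 0 < 2 * n * h * Real.sin a := by positivity
  refine le_of_mul_le_mul_right ?_ hc
  calc 1 / Real.pi * (2 * n * h * Real.sin a)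
      = 2 / Real.pi * (n * h) * Real.sin a := by ring
    _ ≤ |Real.cos (n * t)| * Real.sin a := by gcongr
    _ = |l| * |Real.cos t - Real.cos a| * n := habs
    _ ≤ |l| * (2 * Real.sin a * h) * n := by gcongr
    _ = |l| * (2 * n * h * Real.sin a) := by ring

theorem exists_near_chebyshevAngle {n : ℕ} (hn : 1 ≤ n) {t : ℝ} (ht : t ∈ Set.Icc 0 Real.pi) :
    ∃ k ∈ Finset.Icc 1 n, |t - chebyshevAngle n k| ≤ Real.pi / (2 * n) := by
  have hn0 : (0 : ℝ) < n := by exact_mod_cast hn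
  have hpi := Real.pi_pos
  obtain ⟨k, hk, h1, h2⟩ : ∃ k ∈ Finset.Icc 1 n,
      ((k : ℝ) - 1) * Real.pi ≤ n * t ∧ n * t ≤ k * Real.pi := by
    -- At `t = 0` the ceiling would be 0, outside the index range.
    rcases ht.1.eq_or_lt with rfl | ht0
    · exact ⟨1, Finset.mem_Icc.2 ⟨le_rfl, hn⟩, by simp, by simpa using hpi.le⟩
    · have hs : 0 < n * t / Real.pi := by positivity
      refine ⟨⌈n * t / Real.pi⌉₊, Finset.mem_Icc.2 ⟨Nat.ceil_pos.2 hs, Nat.ceil_le.2 ?_⟩, ?_, ?_⟩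
      · rw [div_le_iff₀ hpi]
        exact mul_le_mul_of_nonneg_left ht.2 hn0.le
      · rw [← le_div_iff₀ hpi]
        linarith [Nat.ceil_lt_add_one hs.le]
      · rw [← div_le_iff₀ hpi]
        exact Nat.le_ceil _
  refine ⟨k, hk, le_of_mul_le_mul_left ?_ hn0⟩
  rw [← abs_of_pos hn0, ← abs_mul, abs_of_pos hn0, mul_sub, mul_chebyshevAngle hn,
    show (n : ℝ) * (Real.pi / (2 * n)) = Real.pi / 2 by field_simp, abs_le]
  constructor <;> linarith

theorem inv_pi_sq_le_sum_sq_lagrangeFundamental {n : ℕ} (hn : 1 ≤ n) {x : ℝ}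
    (hx : x ∈ Set.Icc (-1 : ℝ) 1) :
    (1 / Real.pi) ^ 2 ≤ ∑ k ∈ Finset.Icc 1 n, |lagrangeFundamental n k x| ^ 2 := by
  have ht : Real.arccos x ∈ Set.Icc 0 Real.pi := ⟨Real.arccos_nonneg x, Real.arccos_le_pi x⟩
  obtain ⟨k, hk, hd⟩ := exists_near_chebyshevAngle hn ht
  have h := inv_pi_le_abs_lagrangeFundamental hk ht hd
  rw [Real.cos_arccos hx.1 hx.2] at h
  have := Real.pi_pos
  calc (1 / Real.pi) ^ 2 ≤ |lagrangeFundamental n k x| ^ 2 := by gcongr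
    _ ≤ _ := Finset.single_le_sum (f := fun k => |lagrangeFundamental n k x| ^ 2)
      (fun _ _ => by positivity) hk

/-! ### Sums over pairs and the final estimates -/

theorem sum_Icc_sq_eq (n : ℕ) (a : ℕ → ℝ) :
    (∑ k ∈ Finset.Icc 1 n, a k) ^ 2 = ∑ k ∈ Finset.Icc 1 n, a k ^ 2 +
      2 * ∑ m ∈ Finset.Icc 1 n, ∑ k ∈ Finset.Ico 1 m, a k * a m := by
  induction n with
  | zero => simp
  | succ n ih =>
    have e : Finset.Ico 1 (n + 1) = Finset.Icc 1 n := by ext; simp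
    simp only [Finset.sum_Icc_succ_top (Nat.le_add_left 1 n), add_sq, ih, e,
      ← Finset.sum_mul]
    ring

/-- The Korkine–Chebyshev identity for finite weighted sums. -/
theorem sum_mul_sum_sub_sum_mul_sum_eq (n : ℕ) (l f g : ℕ → ℝ) :
    (∑ k ∈ Finset.Icc 1 n, l k) * (∑ k ∈ Finset.Icc 1 n, f k * g k * l k) -
      (∑ k ∈ Finset.Icc 1 n, f k * l k) * (∑ k ∈ Finset.Icc 1 n, g k * l k) =
    ∑ m ∈ Finset.Icc 1 n, ∑ k ∈ Finset.Ico 1 m, (f k - f m) * (g k - g m) * (l k * l m) := by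
  induction n with
  | zero => simp
  | succ n ih =>
    have e : Finset.Ico 1 (n + 1) = Finset.Icc 1 n := by ext; simp
    have h : ∑ k ∈ Finset.Icc 1 n,
        (f k - f (n + 1)) * (g k - g (n + 1)) * (l k * l (n + 1)) =
        (∑ k ∈ Finset.Icc 1 n, f k * g k * l k) * l (n + 1)
        - (∑ k ∈ Finset.Icc 1 n, f k * l k) * (g (n + 1) * l (n + 1))
        - (∑ k ∈ Finset.Icc 1 n, g k * l k) * (f (n + 1) * l (n + 1))
        + (∑ k ∈ Finset.Icc 1 n, l k) * (f (n + 1) * g (n + 1) * l (n + 1)) := by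
      simp only [Finset.sum_mul, ← Finset.sum_add_distrib, ← Finset.sum_sub_distrib]
      exact Finset.sum_congr rfl fun _ _ => by ring
    simp only [Finset.sum_Icc_succ_top (Nat.le_add_left 1 n), e, h, ← ih]
    ring

theorem discreteOsc_nonneg (n : ℕ) (f : C(Set.Icc (-1 : ℝ) 1, ℝ)) : 0 ≤ discreteOsc n f := by
  refine Real.sSup_nonneg ?_
  rintro d ⟨k, m, -, -, -, rfl⟩
  exact abs_nonneg _

theorem abs_sub_le_discreteOsc {n k m : ℕ} (f : C(Set.Icc (-1 : ℝ) 1, ℝ))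
    (hk : 1 ≤ k) (hkm : k < m) (hm : m ≤ n) :
    |f (chebyshevNode n k) - f (chebyshevNode n m)| ≤ discreteOsc n f := by
  refine le_csSup ?_ ⟨k, m, hk, hkm, hm, rfl⟩
  -- The sup norm bounds all differences, as `le_csSup` requires.
  refine ⟨‖f‖ + ‖f‖, ?_⟩
  rintro d ⟨i, j, -, -, -, rfl⟩
  exact (norm_sub_le _ _).trans (add_le_add (f.norm_coe_le_norm _) (f.norm_coe_le_norm _))

theorem abs_chebyshevFunctional_le {n : ℕ} (hn : 1 ≤ n) (f g : C(Set.Icc (-1 : ℝ) 1, ℝ))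
    (x : ℝ) :
    |chebyshevFunctional n f g x| ≤ discreteOsc n f * discreteOsc n g * offDiagonalSum n x := by
  have h := sum_mul_sum_sub_sum_mul_sum_eq n (fun k => lagrangeFundamental n k x)
    (fun k => f (chebyshevNode n k)) (fun k => g (chebyshevNode n k))
  rw [sum_lagrangeFundamental hn, one_mul] at h
  have hT : chebyshevFunctional n f g x = _ := h
  rw [hT, offDiagonalSum, Finset.mul_sum]
  refine (Finset.abs_sum_le_sum_abs _ _).trans (Finset.sum_le_sum fun m hm => ?_)
  rw [Finset.mul_sum]
  refine (Finset.abs_sum_le_sum_abs _ _).trans (Finset.sum_le_sum fun k hk => ?_)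
  obtain ⟨hk1, hkm⟩ := Finset.mem_Ico.1 hk
  have hmn := (Finset.mem_Icc.1 hm).2
  rw [abs_mul, abs_mul]
  have h1 := abs_sub_le_discreteOsc f hk1 hkm hmn
  have h2 := abs_sub_le_discreteOsc g hk1 hkm hmn
  have := discreteOsc_nonneg n f
  gcongr

theorem lebesgueFunction_sq (n : ℕ) (x : ℝ) :
    lebesgueFunction n x ^ 2 =
      ∑ k ∈ Finset.Icc 1 n, |lagrangeFundamental n k x| ^ 2 + 2 * offDiagonalSum n x := by
  simp only [lebesgueFunction, offDiagonalSum, abs_mul]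
  exact sum_Icc_sq_eq n _

theorem mainTheorem8 :
    ∃ c : ℝ, 0 < c ∧
      ∀ n : ℕ, 1 ≤ n →
      ∀ f g : C(Set.Icc (-1 : ℝ) 1, ℝ),
      ∀ x ∈ Set.Icc (-1 : ℝ) 1, ∀ t : ℝ, x = Real.cos t →
        |chebyshevFunctional n f g x|
            ≤ discreteOsc n f * discreteOsc n g * offDiagonalSum n x ∧
        discreteOsc n f * discreteOsc n g * offDiagonalSum n x
            ≤ discreteOsc n f * discreteOsc n g *
              ((lebesgueFunction n x ^ 2
                - c * (1 + Real.cos ((n : ℝ) * t) ^ 2 * (Real.pi ^ 2 / 6))) / 2) := by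
  have hpi := Real.pi_pos
  have hB : 0 < 1 + Real.pi ^ 2 / 6 := by positivity
  -- Chosen so that `c` times the largest value of the bracket, at `cos² = 1`, is exactly `1/π²`.
  refine ⟨(1 / Real.pi) ^ 2 / (1 + Real.pi ^ 2 / 6), by positivity, ?_⟩
  intro n hn f g x hx t _
  refine ⟨abs_chebyshevFunctional_le hn f g x, ?_⟩
  refine mul_le_mul_of_nonneg_left ?_
    (mul_nonneg (discreteOsc_nonneg n f) (discreteOsc_nonneg n g))
  have hsum := inv_pi_sq_le_sum_sq_lagrangeFundamental hn hx
  have hcos : (1 / Real.pi) ^ 2 / (1 + Real.pi ^ 2 / 6) *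
      (1 + Real.cos ((n : ℝ) * t) ^ 2 * (Real.pi ^ 2 / 6)) ≤ (1 / Real.pi) ^ 2 := by
    calc _ ≤ (1 / Real.pi) ^ 2 / (1 + Real.pi ^ 2 / 6) * (1 + 1 * (Real.pi ^ 2 / 6)) := by
          gcongr
          exact Real.cos_sq_le_one _
      _ = _ := by rw [one_mul, div_mul_cancel₀ _ hB.ne']
  rw [lebesgueFunction_sq]
  linarith
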